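/- Let $D$ be a connected digraph without loops (edges are ordered pairs of distinct vertices). An $s$-arc ($s\ge 0$) in $D$ is a sequence $u_0u_1\ldots u_s$ of vertices such that $(u_i,u_{i+1})$ is an edge for $0\le i<s$ and $u_{i-1}\ne u_{i+1}$ for $0<i<s$. Suppose that $D$ is highly-arc-transitive, that is, for every $s\ge 0$ the automorphism group of $D$ is transitive on the set of $s$-arcs of $D$, and that $D$ is two-ended, that is, the underlying undirected graph of $D$ has exactly two ends, where an end is an equivalence class of rays (one-way infinite paths), two rays being equivalent if there are infinitely many pairwise disjoint finite paths connecting a vertex of one to a vertex of the other. Then there is a directed line $L=\ldots v_{-1}v_0v_1v_2\ldots$ in $D$ (a sequence of vertices such that $(v_i,v_{i+1})$ is an edge for every $i\in\mathbb{Z}$) such that $D$ is the subdigraph induced on the descendant set of $L$; that is, every vertex of $D$ is the last vertex of an $s$-arc, for some $s\ge 0$, starting at a vertex of $L$. -/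

import Mathlib

namespace SimpleGraph

/-- A ray (one-way infinite path) of a graph: consecutive vertices are adjacent and all vertices
are distinct. -/
structure Ray {V : Type*} (G : SimpleGraph V) where
  /-- the sequence of vertices of the ray -/
  vert : ℕ → V
  adj : ∀ n, G.Adj (vert n) (vert (n + 1))
  inj : Function.Injective vert

/-- Two rays are equivalent if there are infinitely many pairwise (vertex-)disjoint finite paths,
each connecting a vertex of the first ray to a vertex of the second. -/
def Ray.Equivalent {V : Type*} {G : SimpleGraph V} (P Q : G.Ray) : Prop :=
  ∃ (a b : ℕ → V) (w : ∀ n, G.Walk (a n) (b n)),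
    (∀ n, (w n).IsPath ∧ a n ∈ Set.range P.vert ∧ b n ∈ Set.range Q.vert) ∧
    Pairwise fun m n => List.Disjoint (w m).support (w n).support

/-- Two rays are equivalent iff no finite set of vertices meets all walks between them. -/
theorem Ray.equivalent_iff {V : Type*} {G : SimpleGraph V} (P Q : G.Ray) :
    P.Equivalent Q ↔ ∀ F : Finset V, ∃ (i j : ℕ) (w : G.Walk (P.vert i) (Q.vert j)),
      ∀ x ∈ w.support, x ∉ F := by
  classical
  constructor
  · rintro ⟨a, b, w, hw, hd⟩ F
    by_contra hcon
    have h : ∀ n, ∃ x : F, (x : V) ∈ (w n).support := by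
      intro n
      by_contra hn
      apply hcon
      obtain ⟨-, ⟨i, hi⟩, ⟨j, hj⟩⟩ := hw n
      refine ⟨i, j, (w n).copy hi.symm hj.symm, fun x hx hxF => hn ⟨⟨x, hxF⟩, ?_⟩⟩
      simpa using hx
    choose f hf using h
    refine not_injective_infinite_finite f fun m n hmn => ?_
    by_contra hne
    exact hd hne (hf m) (by rw [hmn]; exact hf n)
  · intro h
    have : Std.Symm fun x y : (Σ a b : V, G.Walk a b) =>
        List.Disjoint x.2.2.support y.2.2.support := ⟨fun _ _ hxy => hxy.symm⟩
    obtain ⟨f, hf, hr⟩ := exists_seq_of_forall_finset_exists'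
      (α := Σ a b : V, G.Walk a b)
      (fun x => x.2.2.IsPath ∧ x.1 ∈ Set.range P.vert ∧ x.2.1 ∈ Set.range Q.vert)
      (fun x y => List.Disjoint x.2.2.support y.2.2.support)
      (by
        intro s _
        obtain ⟨i, j, w, hw⟩ := h (s.biUnion fun x => x.2.2.support.toFinset)
        refine ⟨⟨_, _, w.bypass⟩, ⟨w.bypass_isPath, ⟨i, rfl⟩, ⟨j, rfl⟩⟩, ?_⟩
        intro x hx v hv hv'
        refine hw v (w.support_bypass_subset_support hv') ?_
        exact Finset.mem_biUnion.2 ⟨x, hx, List.mem_toFinset.2 hv⟩)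
    exact ⟨fun n => (f n).1, fun n => (f n).2.1, fun n => (f n).2.2, hf, hr⟩

theorem Ray.exists_walk {V : Type*} {G : SimpleGraph V} (P : G.Ray) (N k : ℕ) :
    ∃ w : G.Walk (P.vert N) (P.vert (N + k)), ∀ x ∈ w.support, ∃ m, N ≤ m ∧ P.vert m = x := by
  induction k with
  | zero => exact ⟨Walk.nil, fun x hx => ⟨N, le_rfl, ((Walk.mem_support_nil_iff.1 hx).symm)⟩⟩
  | succ k ih =>
    obtain ⟨w, hw⟩ := ih
    refine ⟨w.concat (P.adj (N + k)), fun x hx => ?_⟩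
    rw [Walk.support_concat, List.mem_append, List.mem_singleton] at hx
    rcases hx with hx | hx
    · exact hw x hx
    · exact ⟨N + k + 1, by omega, hx.symm⟩

theorem Ray.exists_tail {V : Type*} {G : SimpleGraph V} (P : G.Ray) (F : Finset V) :
    ∃ N, ∀ m, N ≤ m → P.vert m ∉ F := by
  have hfin : (P.vert ⁻¹' (F : Set V)).Finite := F.finite_toSet.preimage P.inj.injOn
  obtain ⟨N, hN⟩ := hfin.bddAbove
  refine ⟨N + 1, fun m hm hmF => ?_⟩
  have : m ≤ N := hN hmF
  omega

theorem Ray.equivalent_equivalence {V : Type*} (G : SimpleGraph V) :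
    Equivalence (Ray.Equivalent (G := G)) where
  refl P := by
    rw [Ray.equivalent_iff]
    intro F
    obtain ⟨N, hN⟩ := P.exists_tail F
    exact ⟨N, N, Walk.nil, by simpa using hN N le_rfl⟩
  symm {P Q} h := by
    rw [Ray.equivalent_iff] at h ⊢
    intro F
    obtain ⟨i, j, w, hw⟩ := h F
    exact ⟨j, i, w.reverse, by simpa using hw⟩
  trans {P Q R} h₁ h₂ := by
    classical
    rw [Ray.equivalent_iff] at h₁ h₂ ⊢
    intro F
    obtain ⟨N, hN⟩ := Q.exists_tail F
    obtain ⟨i, j, w, hw⟩ := h₁ (F ∪ (Finset.range N).image Q.vert)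
    obtain ⟨i', j', w', hw'⟩ := h₂ (F ∪ (Finset.range N).image Q.vert)
    have key : ∀ m, Q.vert m ∉ F ∪ (Finset.range N).image Q.vert →
        ∃ u : G.Walk (Q.vert N) (Q.vert m), ∀ x ∈ u.support, x ∉ F := by
      intro m hm
      have hNm : N ≤ m := by
        by_contra hlt
        exact hm (Finset.mem_union_right _
          (Finset.mem_image_of_mem _ (Finset.mem_range.2 (by omega))))
      obtain ⟨k, rfl⟩ := Nat.exists_eq_add_of_le hNm
      obtain ⟨u, hu⟩ := Q.exists_walk N k
      refine ⟨u, fun x hx => ?_⟩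
      obtain ⟨m, hm, rfl⟩ := hu x hx
      exact hN m hm
    obtain ⟨u, hu⟩ := key j (hw _ w.end_mem_support)
    obtain ⟨u', hu'⟩ := key i' (hw' _ w'.start_mem_support)
    refine ⟨i, j', w.append (u.reverse.append (u'.append w')), fun x hx => ?_⟩
    simp only [Walk.mem_support_append_iff, Walk.support_reverse, List.mem_reverse] at hx
    rcases hx with hx | hx | hx | hx
    · exact fun hF => hw x hx (Finset.mem_union_left _ hF)
    · exact hu x hx
    · exact hu' x hx
    · exact fun hF => hw' x hx (Finset.mem_union_left _ hF)

/-- Equivalence of rays, as a setoid. -/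
def raySetoid {V : Type*} (G : SimpleGraph V) : Setoid G.Ray :=
  ⟨Ray.Equivalent, Ray.equivalent_equivalence G⟩

/-- The ends of a graph: the equivalence classes of its rays. -/
def RayEnd {V : Type*} (G : SimpleGraph V) : Type _ := Quotient G.raySetoid

end SimpleGraph

namespace Digraph

/-- A digraph without loops. -/
def Loopless {V : Type*} (D : Digraph V) : Prop := ∀ v, ¬ D.Adj v v

/-- A digraph is connected if its underlying undirected graph is. -/
def IsConnected {V : Type*} (D : Digraph V) : Prop := D.toSimpleGraphInclusive.Connected

/-- A digraph is two-ended if its underlying undirected graph has exactly two ends. -/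
def IsTwoEnded {V : Type*} (D : Digraph V) : Prop :=
  Nat.card D.toSimpleGraphInclusive.RayEnd = 2

/-- `u 0, u 1, …, u s` is an `s`-arc: consecutive vertices are joined by edges directed forwards,
and `u (i - 1) ≠ u (i + 1)` for `0 < i < s`. -/
def IsArc {V : Type*} (D : Digraph V) (s : ℕ) (u : Fin (s + 1) → V) : Prop :=
  (∀ i : Fin s, D.Adj (u i.castSucc) (u i.succ)) ∧
  ∀ (i : ℕ) (hi : i + 2 < s + 1), u ⟨i, by omega⟩ ≠ u ⟨i + 2, hi⟩

/-- The automorphisms of a digraph. -/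
abbrev Aut {V : Type*} (D : Digraph V) : Type _ := D.Adj ≃r D.Adj

/-- `s`-arc transitivity: the automorphism group is transitive on the set of `s`-arcs. -/
def IsArcTransitive {V : Type*} (D : Digraph V) (s : ℕ) : Prop :=
  ∀ u v : Fin (s + 1) → V, D.IsArc s u → D.IsArc s v → ∃ g : D.Aut, ∀ i, g (u i) = v i

/-- A digraph is highly-arc-transitive if it is `s`-arc transitive for every `s ≥ 0`. -/
def IsHighlyArcTransitive {V : Type*} (D : Digraph V) : Prop := ∀ s, D.IsArcTransitive s

/-- The descendant set of a vertex: the vertices reachable from it by an `s`-arc, `s ≥ 0`. -/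
def desc {V : Type*} (D : Digraph V) (x : V) : Set V :=
  {y | ∃ (s : ℕ) (u : Fin (s + 1) → V), D.IsArc s u ∧ u 0 = x ∧ u (Fin.last s) = y}

/-- The descendant set of a set of vertices. -/
def descSet {V : Type*} (D : Digraph V) (X : Set V) : Set V := ⋃ x ∈ X, D.desc x

/-- A directed line (two-way infinite arc). -/
def IsDirectedLine {V : Type*} (D : Digraph V) (L : ℤ → V) : Prop :=
  ∀ i, D.Adj (L i) (L (i + 1))

end Digraph

/-! If `D` has a 2-cycle, arc-transitivity makes every edge symmetric, and connectedness alone gives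
reachability. So assume that there is none.

The underlying graph is vertex- and edge-transitive and has two ends. No vertex dominates an end, so
translates of a minimum separator of the ends that lie in a given ball are all minimal separators of
one fixed pair of vertices. There are finitely many of these of a given size, so balls are finite
(`finite_distBall`). Balls of a suitable radius `r` then separate the ends. Counting with signs on
which side of the ball around `x` each vertex lies, relative to a base point, gives a height with
finite fibres whose differences are preserved up to sign (`exists_height`).

Transitivity on 2-arcs forces the height to change by the same `c ≠ 0` along every edge
(`exists_const_step`). The `s`-step descendants of a vertex lie in one fibre, so their number is
bounded and eventually constant in `s`. From then on, following an edge loses no descendants, and by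
connectedness any two vertices of equal height have the same far descendants. Far down, the
descendants of one vertex therefore fill whole fibres, and any directed line reaches everything by
starting far enough back (`exists_mem_stepDesc_line`). -/

namespace SimpleGraph

variable {V : Type*} {G : SimpleGraph V}

/-! ### Sides of a finite vertex set and ends. -/

/-- Two vertices are joined by a walk that avoids `F`. -/
def AvoidReach (G : SimpleGraph V) (F : Set V) (u v : V) : Prop :=
  ∃ w : G.Walk u v, ∀ x ∈ w.support, x ∉ F

namespace AvoidReach

variable {F F' : Set V} {u v x : V}

theorem refl (h : u ∉ F) : G.AvoidReach F u u := ⟨Walk.nil, by simpa using h⟩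

theorem symm (h : G.AvoidReach F u v) : G.AvoidReach F v u := by
  obtain ⟨w, hw⟩ := h
  exact ⟨w.reverse, by simpa using hw⟩

theorem trans (h : G.AvoidReach F u v) (h' : G.AvoidReach F v x) : G.AvoidReach F u x := by
  obtain ⟨w, hw⟩ := h
  obtain ⟨w', hw'⟩ := h'
  refine ⟨w.append w', fun y hy => ?_⟩
  rcases (Walk.mem_support_append_iff _ _).1 hy with hy | hy
  exacts [hw y hy, hw' y hy]

theorem right_notMem (h : G.AvoidReach F u v) : v ∉ F := by
  obtain ⟨w, hw⟩ := h
  exact hw _ w.end_mem_support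

theorem left_notMem (h : G.AvoidReach F u v) : u ∉ F := h.symm.right_notMem

theorem of_adj (h : G.Adj u v) (hu : u ∉ F) (hv : v ∉ F) : G.AvoidReach F u v :=
  ⟨h.toWalk, by simp [hu, hv]⟩

theorem mono (hF : F ⊆ F') (h : G.AvoidReach F' u v) : G.AvoidReach F u v := by
  obtain ⟨w, hw⟩ := h
  exact ⟨w, fun x hx hxF => hw x hx (hF hxF)⟩

theorem of_mem_support (w : G.Walk u v) (hw : ∀ x ∈ w.support, x ∉ F) (hx : x ∈ w.support) :
    G.AvoidReach F u x := by
  classical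
  exact ⟨w.takeUntil x hx, fun y hy => hw y (w.support_takeUntil_subset_support hx hy)⟩

theorem map (g : G ≃g G) (h : G.AvoidReach F u v) : G.AvoidReach (g '' F) (g u) (g v) := by
  obtain ⟨w, hw⟩ := h
  refine ⟨w.map g.toHom, fun x hx => ?_⟩
  rw [Walk.support_map, List.mem_map] at hx
  obtain ⟨y, hy, rfl⟩ := hx
  rintro ⟨z, hz, hzy⟩
  exact hw y hy ((g.injective hzy) ▸ hz)

theorem map_iff (g : G ≃g G) :
    G.AvoidReach (g '' F) (g u) (g v) ↔ G.AvoidReach F u v := by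
  refine ⟨fun h => ?_, map g⟩
  have := h.map g.symm
  simpa [Set.image_image] using this

end AvoidReach

/-- On a walk that starts inside a set and ends outside there is an edge leaving the set. -/
theorem Walk.exists_adj_leaving {S : Set V} {u v : V} (w : G.Walk u v) (hu : u ∈ S)
    (hv : v ∉ S) : ∃ a b, a ∈ S ∧ b ∉ S ∧ G.Adj a b := by
  induction w with
  | nil => exact absurd hu hv
  | @cons a b c h p ih =>
    by_cases hb : b ∈ S
    · exact ih hb hv
    · exact ⟨a, b, hu, hb, h⟩

namespace Ray

variable {F F' : Set V} {u v : V}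

/-- The vertices of `G - F` that can be joined in `G - F` to a tail of the ray `P`. -/
def side (P : G.Ray) (F : Set V) : Set V :=
  {v | ∃ N, (∀ m, N ≤ m → P.vert m ∉ F) ∧ G.AvoidReach F v (P.vert N)}

theorem exists_tail_of_finite (P : G.Ray) (hF : F.Finite) : ∃ N, ∀ m, N ≤ m → P.vert m ∉ F := by
  obtain ⟨N, hN⟩ := P.exists_tail hF.toFinset
  exact ⟨N, fun m hm h => hN m hm (hF.mem_toFinset.2 h)⟩

theorem avoidReach_tail (P : G.Ray) {N n : ℕ} (hN : ∀ m, N ≤ m → P.vert m ∉ F) (hn : N ≤ n) :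
    G.AvoidReach F (P.vert N) (P.vert n) := by
  obtain ⟨k, rfl⟩ := Nat.exists_eq_add_of_le hn
  obtain ⟨w, hw⟩ := P.exists_walk N k
  refine ⟨w, fun x hx => ?_⟩
  obtain ⟨m, hm, rfl⟩ := hw x hx
  exact hN m hm

theorem side_notMem {P : G.Ray} (h : v ∈ P.side F) : v ∉ F := by
  obtain ⟨N, -, h⟩ := h
  exact h.left_notMem

theorem mem_side_of_avoidReach {P : G.Ray} (hu : u ∈ P.side F) (h : G.AvoidReach F u v) :
    v ∈ P.side F := by
  obtain ⟨N, hN, hu⟩ := hu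
  exact ⟨N, hN, h.symm.trans hu⟩

theorem mem_side_of_adj {P : G.Ray} (hu : u ∈ P.side F) (h : G.Adj u v) (hv : v ∉ F) :
    v ∈ P.side F :=
  mem_side_of_avoidReach hu (.of_adj h (side_notMem hu) hv)

theorem avoidReach_of_mem_side {P : G.Ray} (hu : u ∈ P.side F) (hv : v ∈ P.side F) :
    G.AvoidReach F u v := by
  obtain ⟨N, hN, hu⟩ := hu
  obtain ⟨M, hM, hv⟩ := hv
  rcases le_total N M with h | h
  · exact (hu.trans (P.avoidReach_tail hN h)).trans hv.symm
  · exact hu.trans (hv.trans (P.avoidReach_tail hM h)).symm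

theorem vert_mem_side (P : G.Ray) {N n : ℕ} (hN : ∀ m, N ≤ m → P.vert m ∉ F) (hn : N ≤ n) :
    P.vert n ∈ P.side F :=
  ⟨n, fun m hm => hN m (hn.trans hm), .refl (hN n hn)⟩

theorem side_nonempty (P : G.Ray) (hF : F.Finite) : (P.side F).Nonempty := by
  obtain ⟨N, hN⟩ := P.exists_tail_of_finite hF
  exact ⟨_, P.vert_mem_side hN le_rfl⟩

theorem side_anti (P : G.Ray) (h : F ⊆ F') : P.side F' ⊆ P.side F := by
  rintro v ⟨N, hN, hv⟩
  exact ⟨N, fun m hm hF => hN m hm (h hF), hv.mono h⟩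

/-- A side that a finite set `F'` does not meet is contained in the corresponding side of `F'`. -/
theorem side_subset_side (P : G.Ray) (hF' : F'.Finite) (h : Disjoint (P.side F) F') :
    P.side F ⊆ P.side F' := by
  intro v hv
  obtain ⟨N, hN, hvN⟩ := id hv
  obtain ⟨M, hM⟩ := P.exists_tail_of_finite hF'
  have h1 : P.vert (max N M) ∈ P.side F := P.vert_mem_side hN (le_max_left _ _)
  obtain ⟨w, hw⟩ := avoidReach_of_mem_side hv h1
  refine ⟨max N M, fun m hm => hM m ((le_max_right _ _).trans hm), w, fun x hx hxF => ?_⟩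
  exact Set.disjoint_left.1 h (mem_side_of_avoidReach hv (.of_mem_support w hw hx)) hxF

theorem Equivalent.side_subset {P Q : G.Ray} (h : P.Equivalent Q) (hF : F.Finite) :
    P.side F ⊆ Q.side F := by
  classical
  obtain ⟨N, hN⟩ := P.exists_tail_of_finite hF
  obtain ⟨M, hM⟩ := Q.exists_tail_of_finite hF
  -- Forbidding the initial segments as well forces the connecting walk to join the two tails that
  -- avoid `F`.
  obtain ⟨i, j, w, hw⟩ := (equivalent_iff P Q).1 h
    (hF.toFinset ∪ ((Finset.range N).image P.vert ∪ (Finset.range M).image Q.vert))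
  have hi : N ≤ i := by
    by_contra hlt
    refine hw _ w.start_mem_support ?_
    simp only [Finset.mem_union, Finset.mem_image, Finset.mem_range]
    exact Or.inr (Or.inl ⟨i, by omega, rfl⟩)
  have hj : M ≤ j := by
    by_contra hlt
    refine hw _ w.end_mem_support ?_
    simp only [Finset.mem_union, Finset.mem_image, Finset.mem_range]
    exact Or.inr (Or.inr ⟨j, by omega, rfl⟩)
  have hij : G.AvoidReach F (P.vert i) (Q.vert j) :=
    ⟨w, fun x hx hxF => hw x hx (Finset.mem_union_left _ (hF.mem_toFinset.2 hxF))⟩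
  intro v hv
  exact mem_side_of_avoidReach (Q.vert_mem_side hM hj)
    (hij.symm.trans (avoidReach_of_mem_side (P.vert_mem_side hN hi) hv))

theorem Equivalent.side_eq {P Q : G.Ray} (h : P.Equivalent Q) (hF : F.Finite) :
    P.side F = Q.side F :=
  (h.side_subset hF).antisymm (((equivalent_equivalence G).symm h).side_subset hF)

theorem exists_disjoint_side {P Q : G.Ray} (h : ¬ P.Equivalent Q) :
    ∃ F : Finset V, Disjoint (P.side F) (Q.side F) := by
  rw [equivalent_iff] at h
  push Not at h
  obtain ⟨F, hF⟩ := h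
  refine ⟨F, Set.disjoint_left.2 ?_⟩
  rintro v ⟨N, -, hv⟩ ⟨M, -, hv'⟩
  obtain ⟨w, hw⟩ := hv.symm.trans hv'
  obtain ⟨x, hx, hxF⟩ := hF N M w
  exact hw x hx hxF

theorem not_equivalent_of_disjoint {P Q : G.Ray} (hF : F.Finite)
    (h : Disjoint (P.side F) (Q.side F)) : ¬ P.Equivalent Q := by
  intro he
  obtain ⟨v, hv⟩ := P.side_nonempty hF
  exact Set.disjoint_left.1 h hv (he.side_subset hF hv)

/-- If `F` is finite and non-empty then some vertex of `F` has a neighbour in `P.side F`. -/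
theorem exists_adj_side (hG : G.Connected) (P : G.Ray) (hF : F.Finite) (hne : F.Nonempty) :
    ∃ a b, a ∈ P.side F ∧ b ∈ F ∧ G.Adj a b := by
  obtain ⟨u, hu⟩ := P.side_nonempty hF
  obtain ⟨v, hv⟩ := hne
  obtain ⟨w⟩ := hG.preconnected u v
  obtain ⟨a, b, ha, hb, hab⟩ := w.exists_adj_leaving hu (fun h => side_notMem h hv)
  refine ⟨a, b, ha, ?_, hab⟩
  by_contra hbF
  exact hb (mem_side_of_adj ha hab hbF)

/-- The image of a ray under an automorphism. -/
def map (g : G ≃g G) (P : G.Ray) : G.Ray where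
  vert n := g (P.vert n)
  adj n := g.map_adj_iff.2 (P.adj n)
  inj := g.injective.comp P.inj

theorem mem_side_map (g : G ≃g G) (P : G.Ray) :
    g v ∈ (P.map g).side (g '' F) ↔ v ∈ P.side F := by
  simp only [side, map, Set.mem_ofPred_eq, AvoidReach.map_iff, g.injective.mem_set_image]

theorem side_map (g : G ≃g G) (P : G.Ray) (F : Set V) :
    (P.map g).side (g '' F) = g '' P.side F := by
  ext x
  obtain ⟨v, rfl⟩ := g.surjective x
  rw [mem_side_map, g.injective.mem_set_image]

end Ray

end SimpleGraph

/-! ### Local finiteness. -/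

namespace SimpleGraph

variable {V : Type*} {G : SimpleGraph V}

/-- There are only finitely many inclusion-minimal separators of two given vertices that have a
given finite size. -/
theorem finite_minimal_separators (a b : V) (k : ℕ) : ∀ S : Set V,
    {F : Finset V | F.card = k ∧ ¬ G.AvoidReach (↑F ∪ S) a b ∧
      ∀ F' ⊂ F, G.AvoidReach (↑F' ∪ S) a b}.Finite := by
  classical
  induction k with
  | zero =>
    intro S
    refine (Set.finite_singleton ∅).subset fun F hF => ?_
    exact Finset.card_eq_zero.1 hF.1
  | succ k ih =>
    intro S
    by_cases hS : G.AvoidReach S a b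
    · obtain ⟨w, hw⟩ := hS
      refine (w.support.toFinset.finite_toSet.biUnion fun p _ =>
        (ih (insert p S)).image (insert p)).subset ?_
      rintro F ⟨hk, hsep, hmin⟩
      obtain ⟨p, hp, hpF⟩ : ∃ p ∈ w.support, p ∈ F := by
        by_contra! hcon
        refine hsep ⟨w, fun x hx hxF => ?_⟩
        rcases hxF with hxF | hxF
        exacts [hcon x hx hxF, hw x hx hxF]
      have key : ∀ F' : Finset V, (↑F' ∪ insert p S : Set V) = ↑(insert p F') ∪ S := by
        intro F'
        ext x
        simp only [Set.mem_union, Set.mem_insert_iff, Finset.coe_insert, Finset.mem_coe]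
        tauto
      simp only [Set.mem_iUnion]
      refine ⟨p, by simpa using hp, F.erase p, ⟨?_, ?_, ?_⟩, Finset.insert_erase hpF⟩
      · rw [Finset.card_erase_of_mem hpF, hk]; rfl
      · rwa [key, Finset.insert_erase hpF]
      · intro F' hF'
        rw [key]
        apply hmin
        have hp' : p ∉ F' := fun h => Finset.notMem_erase p F (hF'.1 h)
        refine ⟨Finset.insert_subset hpF (hF'.1.trans (Finset.erase_subset _ _)), fun h => ?_⟩
        refine hF'.2 fun z hz => ?_
        obtain ⟨hzp, hzF⟩ := Finset.mem_erase.1 hz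
        exact (Finset.mem_insert.1 (h hzF)).resolve_left hzp
    · refine Set.Finite.subset Set.finite_empty ?_
      rintro F ⟨hk, -, hmin⟩
      obtain ⟨x, hx⟩ := Finset.card_pos.1 (by omega : 0 < F.card)
      exact hS ((hmin _ (Finset.erase_ssubset hx)).mono Set.subset_union_right)

namespace Ray

/-- Every automorphism fixes or swaps the ends of `P` and `Q`. -/
def PairInvariant (P Q : G.Ray) : Prop := ∀ g : G ≃g G,
  (∀ F : Set V, F.Finite →
    P.side (g '' F) = g '' P.side F ∧ Q.side (g '' F) = g '' Q.side F) ∨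
  (∀ F : Set V, F.Finite →
    P.side (g '' F) = g '' Q.side F ∧ Q.side (g '' F) = g '' P.side F)

theorem PairInvariant.swap {P Q : G.Ray} (h : P.PairInvariant Q) : Q.PairInvariant P := fun g =>
  (h g).imp (fun h F hF => (h F hF).symm) (fun h F hF => (h F hF).symm)

/-- An automorphism maps inequivalent rays to inequivalent rays, so it permutes the two classes, and
a side depends only on the class of its ray. -/
theorem pairInvariant_of_two_ends {P Q : G.Ray} (hPQ : ¬ P.Equivalent Q)
    (h : ∀ R : G.Ray, R.Equivalent P ∨ R.Equivalent Q) : P.PairInvariant Q := by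
  obtain ⟨F, hF⟩ := exists_disjoint_side hPQ
  intro g
  have hF' : Disjoint ((P.map g).side (g '' F)) ((Q.map g).side (g '' F)) := by
    rw [side_map, side_map]
    exact (Set.disjoint_image_iff g.injective).2 hF
  have hne := not_equivalent_of_disjoint (F.finite_toSet.image g) hF'
  have hE := equivalent_equivalence G
  rcases h (P.map g) with hP | hP <;> rcases h (Q.map g) with hQ | hQ
  · exact absurd (hE.trans hP (hE.symm hQ)) hne
  · exact .inl fun F hF => by
      rw [← hP.side_eq (hF.image g), ← hQ.side_eq (hF.image g), side_map, side_map]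
      exact ⟨rfl, rfl⟩
  · exact .inr fun F hF => by
      rw [← hP.side_eq (hF.image g), ← hQ.side_eq (hF.image g), side_map, side_map]
      exact ⟨rfl, rfl⟩
  · exact absurd (hE.trans hP (hE.symm hQ)) hne

theorem PairInvariant.disjoint_image {P Q : G.Ray} (h : P.PairInvariant Q) (g : G ≃g G)
    {F : Set V} (hF : F.Finite) :
    Disjoint (P.side (g '' F)) (Q.side (g '' F)) ↔ Disjoint (P.side F) (Q.side F) := by
  rcases h g with h | h
  · rw [(h F hF).1, (h F hF).2, Set.disjoint_image_iff g.injective]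
  · rw [(h F hF).1, (h F hF).2, Set.disjoint_image_iff g.injective, disjoint_comm]

/-- The vertices that no finite set separates from the end of `P`. -/
def dominators (P : G.Ray) : Set V := {x | ∀ F : Set V, F.Finite → x ∉ F → x ∈ P.side F}

theorem mem_dominators_image {P R : G.Ray} {g : G ≃g G}
    (h : ∀ F : Set V, F.Finite → P.side (g '' F) = g '' R.side F) (x : V) :
    g x ∈ P.dominators ↔ x ∈ R.dominators := by
  constructor
  · intro hx F hF hxF
    have := hx (g '' F) (hF.image g) (by rwa [g.injective.mem_set_image])
    rwa [h F hF, g.injective.mem_set_image] at this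
  · intro hx F hF hxF
    have h1 : g '' (g ⁻¹' F) = F := Set.image_preimage_eq F g.surjective
    have hF1 : (g ⁻¹' F).Finite := hF.preimage g.injective.injOn
    rw [← h1, h _ hF1, g.injective.mem_set_image]
    exact hx _ hF1 hxF

/-- One dominating vertex would, by vertex-transitivity, make every vertex dominate exactly one of
the two ends. Some edges then join two dominators of the same end (far out on `P`), while
connectedness yields an edge between the two classes, against edge-transitivity. -/
theorem dominators_eq_empty (hG : G.Connected) (hV : ∀ x y : V, ∃ g : G ≃g G, g x = y)
    (hE : ∀ a b c d : V, G.Adj a b → G.Adj c d →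
      ∃ g : G ≃g G, (g a = c ∧ g b = d) ∨ (g a = d ∧ g b = c))
    {P Q : G.Ray} (hS : P.PairInvariant Q) {F : Set V} (hF : F.Finite)
    (hd : Disjoint (P.side F) (Q.side F)) : P.dominators = ∅ := by
  have hmap : ∀ g : G ≃g G,
      (∀ x, (g x ∈ P.dominators ↔ x ∈ P.dominators) ∧ (g x ∈ Q.dominators ↔ x ∈ Q.dominators)) ∨
      (∀ x, (g x ∈ P.dominators ↔ x ∈ Q.dominators) ∧ (g x ∈ Q.dominators ↔ x ∈ P.dominators)) :=
    fun g => (hS g).imp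
      (fun h x => ⟨mem_dominators_image (fun F hF => (h F hF).1) x,
        mem_dominators_image (fun F hF => (h F hF).2) x⟩)
      (fun h x => ⟨mem_dominators_image (fun F hF => (h F hF).1) x,
        mem_dominators_image (fun F hF => (h F hF).2) x⟩)
  have hP : ∀ x ∈ P.side F, x ∉ Q.dominators := fun x hx hxQ =>
    Set.disjoint_left.1 hd hx (hxQ F hF (side_notMem hx))
  have hQ : ∀ x ∈ Q.side F, x ∉ P.dominators := fun x hx hxP =>
    Set.disjoint_left.1 hd (hxP F hF (side_notMem hx)) hx
  rw [Set.eq_empty_iff_forall_notMem]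
  intro x₀ hx₀
  have hall : ∀ x, x ∈ P.dominators ∨ x ∈ Q.dominators := by
    intro x
    obtain ⟨g, rfl⟩ := hV x₀ x
    rcases hmap g with h | h
    · exact .inl ((h _).1.2 hx₀)
    · exact .inr ((h _).2.2 hx₀)
  have hdisj : ∀ x ∈ P.dominators, x ∉ Q.dominators := by
    intro x hxP hxQ
    obtain ⟨y, hy⟩ := Q.side_nonempty hF
    obtain ⟨g, rfl⟩ := hV x y
    rcases hmap g with h | h
    · exact hQ _ hy ((h _).1.2 hxP)
    · exact hQ _ hy ((h _).1.2 hxQ)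
  obtain ⟨N, hN⟩ := P.exists_tail_of_finite hF
  have h0 : P.vert N ∈ P.dominators :=
    (hall _).resolve_right (hP _ (P.vert_mem_side hN le_rfl))
  have h1 : P.vert (N + 1) ∈ P.dominators :=
    (hall _).resolve_right (hP _ (P.vert_mem_side hN (Nat.le_succ N)))
  obtain ⟨y, hy⟩ := Q.side_nonempty hF
  obtain ⟨w⟩ := hG.preconnected (P.vert N) y
  obtain ⟨a, b, ha, hb, hab⟩ := w.exists_adj_leaving h0 (hQ y hy)
  obtain ⟨g, ⟨rfl, rfl⟩ | ⟨rfl, rfl⟩⟩ := hE _ _ a b (P.adj N) hab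
  · rcases hmap g with h | h
    · exact hb ((h _).1.2 h1)
    · exact hdisj _ ha ((h _).2.2 h0)
  · rcases hmap g with h | h
    · exact hb ((h _).1.2 h0)
    · exact hdisj _ ha ((h _).2.2 h1)

end Ray

/-- The ball of radius `n` around `x`. -/
def distBall (G : SimpleGraph V) (x : V) (n : ℕ) : Set V := {y | G.dist x y ≤ n}

theorem mem_distBall_self (x : V) (n : ℕ) : x ∈ G.distBall x n := by
  simp [distBall]

theorem Connected.exists_adj_of_dist_le_succ (hG : G.Connected) {x y : V} {n : ℕ}
    (h : G.dist x y ≤ n + 1) : G.dist x y ≤ n ∨ ∃ z, G.Adj y z ∧ G.dist x z ≤ n := by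
  obtain ⟨w, hw⟩ := hG.exists_walk_length_eq_dist y x
  rw [G.dist_comm] at hw
  cases w with
  | nil => exact .inl (by simp)
  | @cons _ z _ h' p =>
    refine .inr ⟨z, h', ?_⟩
    rw [G.dist_comm]
    have := dist_le p
    rw [Walk.length_cons] at hw
    omega

theorem Iso.dist_map (hG : G.Connected) (g : G ≃g G) (x y : V) :
    G.dist (g x) (g y) = G.dist x y := by
  have key : ∀ (g : G ≃g G) (x y : V), G.dist (g x) (g y) ≤ G.dist x y := by
    intro g x y
    obtain ⟨w, hw⟩ := hG.exists_walk_length_eq_dist x y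
    rw [← hw, ← Walk.length_map g.toHom w]
    exact dist_le _
  refine le_antisymm (key g x y) ?_
  simpa using key g.symm (g x) (g y)

theorem image_distBall (hG : G.Connected) (g : G ≃g G) (x : V) (n : ℕ) :
    g '' G.distBall x n = G.distBall (g x) n := by
  ext y
  obtain ⟨y, rfl⟩ := g.surjective y
  rw [g.injective.mem_set_image]
  simp only [distBall, Set.mem_ofPred_eq, g.dist_map hG]

/-- Balls are not yet known to be finite. A finite `F` that works for radius `n` is enlarged by sets
cutting each of its own vertices off from the end: a new vertex of the next ball can reach the end
only if its neighbour in the smaller ball could, or if that neighbour lies in `F`. -/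
theorem Ray.exists_finite_disjoint_distBall (hG : G.Connected) {P : G.Ray}
    (hP : P.dominators = ∅) (x : V) (n : ℕ) :
    ∃ F : Set V, F.Finite ∧ Disjoint (G.distBall x n) (P.side F) := by
  have h : ∀ y, ∃ F : Set V, F.Finite ∧ y ∉ F ∧ y ∉ P.side F := by
    intro y
    have : y ∉ P.dominators := by simp [hP]
    simpa [dominators] using this
  choose K hK hyK hys using h
  induction n with
  | zero =>
    refine ⟨K x, hK x, Set.disjoint_left.2 fun y hy hyx => hys x ?_⟩
    have : x = y := (hG.dist_eq_zero_iff).1 (Nat.le_zero.1 hy)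
    rwa [this] at hyx ⊢
  | succ n ih =>
    obtain ⟨F, hF, hd⟩ := ih
    refine ⟨F ∪ ⋃ y ∈ F, K y, hF.union (hF.biUnion fun y _ => hK y),
      Set.disjoint_left.2 fun y hy hyF => ?_⟩
    have hyF' := P.side_anti Set.subset_union_left hyF
    rcases hG.exists_adj_of_dist_le_succ hy with hy | ⟨z, hyz, hz⟩
    · exact Set.disjoint_left.1 hd hy hyF'
    · by_cases hzF : z ∈ F
      · refine hys z (mem_side_of_adj (P.side_anti ?_ hyF) hyz (hyK z))
        exact (Set.subset_biUnion_of_mem (u := K) hzF).trans Set.subset_union_right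
      · exact Set.disjoint_left.1 hd hz (mem_side_of_adj hyF' hyz hzF)

/-- A connected graph that is transitive on vertices and on edges and in which a finite set
separates two ends, which are the only ones up to automorphisms, is locally finite. -/
theorem finite_distBall (hG : G.Connected) (hV : ∀ x y : V, ∃ g : G ≃g G, g x = y)
    (hE : ∀ a b c d : V, G.Adj a b → G.Adj c d →
      ∃ g : G ≃g G, (g a = c ∧ g b = d) ∨ (g a = d ∧ g b = c))
    {P Q : G.Ray} (hS : P.PairInvariant Q) (hPQ : ¬ P.Equivalent Q) (x : V) (n : ℕ) :
    (G.distBall x n).Finite := by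
  classical
  -- `F₀` is an end separator of minimum size; its translates containing the points of the ball will
  -- be the finitely many sets covering it.
  obtain ⟨F₀, hF₀, hmin⟩ := (measure (Finset.card (α := V))).wf.has_min
    {F : Finset V | Disjoint (P.side F) (Q.side F)} (Ray.exists_disjoint_side hPQ)
  have hmin' : ∀ F : Finset V, F.card < F₀.card → ¬ Disjoint (P.side F) (Q.side F) :=
    fun F hlt hF => hmin F hF hlt
  obtain ⟨p, hp⟩ : F₀.Nonempty := by
    by_contra hne
    rw [Finset.not_nonempty_iff_eq_empty] at hne
    subst hne
    obtain ⟨a, ha⟩ := P.side_nonempty (Finset.finite_toSet ∅)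
    obtain ⟨b, hb⟩ := Q.side_nonempty (Finset.finite_toSet ∅)
    obtain ⟨w⟩ := hG.preconnected a b
    exact Set.disjoint_left.1 hF₀ (Ray.mem_side_of_avoidReach ha ⟨w, by simp⟩) hb
  obtain ⟨d, hd⟩ : ∃ d, ∀ y ∈ F₀, G.dist p y ≤ d :=
    ⟨F₀.sup (G.dist p), fun y hy => Finset.le_sup (f := G.dist p) hy⟩
  -- A translate of `F₀` taking `p` into the ball of radius `n` stays within radius `n + d`.
  -- Vertices `a`, `b` beyond `A`, `B` thus lie on the `P`- and `Q`-sides of all such translates and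
  -- of their subsets.
  obtain ⟨A, hA, hAd⟩ := Ray.exists_finite_disjoint_distBall hG
    (Ray.dominators_eq_empty hG hV hE hS F₀.finite_toSet hF₀) x (n + d)
  obtain ⟨B, hB, hBd⟩ := Ray.exists_finite_disjoint_distBall hG
    (Ray.dominators_eq_empty hG hV hE hS.swap F₀.finite_toSet hF₀.symm) x (n + d)
  obtain ⟨a, ha⟩ := P.side_nonempty hA
  obtain ⟨b, hb⟩ := Q.side_nonempty hB
  have hfin := finite_minimal_separators (G := G) a b F₀.card ∅
  refine (hfin.biUnion fun F _ => F.finite_toSet).subset fun y hy => ?_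
  obtain ⟨g, rfl⟩ := hV p y
  have hsub : ((F₀.image g : Finset V) : Set V) ⊆ G.distBall x (n + d) := by
    intro z hz
    obtain ⟨z, hzF, rfl⟩ := Finset.mem_image.1 (Finset.mem_coe.1 hz)
    have h1 : G.dist x (g z) ≤ G.dist x (g p) + G.dist (g p) (g z) := hG.dist_triangle
    rw [g.dist_map hG] at h1
    have h2 := hd z hzF
    have h3 : G.dist x (g p) ≤ n := hy
    show G.dist x (g z) ≤ n + d
    omega
  simp only [Set.mem_iUnion]
  refine ⟨F₀.image g, ⟨Finset.card_image_of_injective _ g.injective, ?_, ?_⟩,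
    Finset.mem_coe.2 (Finset.mem_image_of_mem g hp)⟩
  · have ha' := P.side_subset_side (Finset.finite_toSet _) (hAd.symm.mono_right hsub) ha
    have hb' := Q.side_subset_side (Finset.finite_toSet _) (hBd.symm.mono_right hsub) hb
    rw [Set.union_empty]
    intro hab
    have := (hS.disjoint_image g F₀.finite_toSet).2 hF₀
    rw [← Finset.coe_image] at this
    exact Set.disjoint_left.1 this (Ray.mem_side_of_avoidReach ha' hab) hb'
  · intro F' hF'
    have hsub : (F' : Set V) ⊆ G.distBall x (n + d) :=
      (Finset.coe_subset.2 hF'.1).trans hsub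
    have ha' := P.side_subset_side (Finset.finite_toSet _) (hAd.symm.mono_right hsub) ha
    have hb' := Q.side_subset_side (Finset.finite_toSet _) (hBd.symm.mono_right hsub) hb
    -- A proper subset is too small to separate the ends, so `a` and `b` are joined through a vertex
    -- common to both sides.
    have hlt : F'.card < F₀.card := by
      have := Finset.card_lt_card hF'
      rwa [Finset.card_image_of_injective _ g.injective] at this
    obtain ⟨z, hzP, hzQ⟩ := Set.not_disjoint_iff.1 (hmin' F' hlt)
    rw [Set.union_empty]
    exact (Ray.avoidReach_of_mem_side ha' hzP).trans (Ray.avoidReach_of_mem_side hzQ hb')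

end SimpleGraph

/-! ### The height function. -/

namespace SimpleGraph

variable {V : Type*} {G : SimpleGraph V}

theorem avoidReach_of_disjoint_distBall (hG : G.Connected) {F : Set V} {x y : V} {n : ℕ}
    (hd : Disjoint (G.distBall x n) F) (hy : y ∈ G.distBall x n) : G.AvoidReach F x y := by
  classical
  obtain ⟨w, hw⟩ := hG.exists_walk_length_eq_dist x y
  refine ⟨w, fun z hz => Set.disjoint_left.1 hd ?_⟩
  have h1 := dist_le (w.takeUntil z hz)
  have h2 := w.length_takeUntil_le_length hz
  have h3 : G.dist x y ≤ n := hy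
  show G.dist x z ≤ n
  omega

theorem disjoint_distBall (hG : G.Connected) {x y : V} {r : ℕ} (h : 2 * r < G.dist x y) :
    Disjoint (G.distBall x r) (G.distBall y r) := by
  refine Set.disjoint_left.2 fun z hx hy => ?_
  have h1 : G.dist x y ≤ G.dist x z + G.dist z y := hG.dist_triangle
  have h2 : G.dist x z ≤ r := hx
  have h3 : G.dist y z ≤ r := hy
  rw [G.dist_comm] at h3
  omega

namespace Ray

/-- All balls are finite and each ball of radius `r` separates the ends of `P` and `Q`. -/
structure BallSeparated (P Q : G.Ray) (r : ℕ) : Prop where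
  connected : G.Connected
  finite : ∀ x n, (G.distBall x n).Finite
  disjoint : ∀ x, Disjoint (P.side (G.distBall x r)) (Q.side (G.distBall x r))

theorem BallSeparated.swap {P Q : G.Ray} {r : ℕ} (h : P.BallSeparated Q r) :
    Q.BallSeparated P r :=
  ⟨h.connected, h.finite, fun x => (h.disjoint x).symm⟩

theorem exists_ballSeparated (hG : G.Connected) (hV : ∀ x y : V, ∃ g : G ≃g G, g x = y)
    {P Q : G.Ray} (hS : P.PairInvariant Q) (hPQ : ¬ P.Equivalent Q)
    (hfin : ∀ x n, (G.distBall x n).Finite) : ∃ r, P.BallSeparated Q r := by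
  obtain ⟨F, hF⟩ := exists_disjoint_side hPQ
  have x := P.vert 0
  have hsub : (F : Set V) ⊆ G.distBall x (F.sup (G.dist x)) := fun y hy =>
    Finset.le_sup (f := G.dist x) hy
  refine ⟨F.sup (G.dist x), hG, hfin, fun y => ?_⟩
  obtain ⟨g, rfl⟩ := hV x y
  rw [← image_distBall hG, hS.disjoint_image g (hfin _ _)]
  exact hF.mono (P.side_anti hsub) (Q.side_anti hsub)

namespace BallSeparated

variable {P Q : G.Ray} {r : ℕ} {x y z : V}

/-- The ball around `y` lies wholly on the `Q`-side of the ball around `x`, so it misses the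
`P`-side, which therefore stays connected to the end of `P`. This places `x` on the `P`-side of the
ball around `y`, and the argument repeats with the roles exchanged. -/
theorem side_le (h : P.BallSeparated Q r) (hxy : 2 * r < G.dist x y)
    (hy : y ∈ Q.side (G.distBall x r)) :
    P.side (G.distBall x r) ⊆ P.side (G.distBall y r) ∧ x ∈ P.side (G.distBall y r) ∧
      Q.side (G.distBall y r) ⊆ Q.side (G.distBall x r) := by
  have hd := disjoint_distBall h.connected hxy
  have hyQ : G.distBall y r ⊆ Q.side (G.distBall x r) := fun z hz =>
    mem_side_of_avoidReach hy (avoidReach_of_disjoint_distBall h.connected hd.symm hz)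
  have h1 : P.side (G.distBall x r) ⊆ P.side (G.distBall y r) :=
    P.side_subset_side (h.finite _ _) ((h.disjoint x).mono_right hyQ)
  obtain ⟨a, b, ha, hb, hab⟩ := P.exists_adj_side h.connected (h.finite x r)
    ⟨x, mem_distBall_self x r⟩
  have hx : x ∈ P.side (G.distBall y r) :=
    mem_side_of_avoidReach (mem_side_of_adj (h1 ha) hab (Set.disjoint_left.1 hd hb))
      (avoidReach_of_disjoint_distBall h.connected hd hb).symm
  have hxP : G.distBall x r ⊆ P.side (G.distBall y r) := fun z hz =>
    mem_side_of_avoidReach hx (avoidReach_of_disjoint_distBall h.connected hd hz)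
  exact ⟨h1, hx, Q.side_subset_side (h.finite _ _) ((h.disjoint y).symm.mono_right hxP)⟩

/-- If `y` were on neither side of the ball around `x`, then `x` would be joined to both ends
outside the ball around `y`, which separates them. -/
theorem mem_side_or (h : P.BallSeparated Q r) (hxy : 2 * r < G.dist x y) :
    y ∈ P.side (G.distBall x r) ∨ y ∈ Q.side (G.distBall x r) := by
  have hd := disjoint_distBall h.connected hxy
  by_contra! hcon
  have key : ∀ R : G.Ray, y ∉ R.side (G.distBall x r) → x ∈ R.side (G.distBall y r) := by
    intro R hR
    have h1 : R.side (G.distBall x r) ⊆ R.side (G.distBall y r) := by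
      refine R.side_subset_side (h.finite _ _) (Set.disjoint_left.2 fun z hz hzy => hR ?_)
      exact mem_side_of_avoidReach hz
        (avoidReach_of_disjoint_distBall h.connected hd.symm hzy).symm
    obtain ⟨a, b, ha, hb, hab⟩ := R.exists_adj_side h.connected (h.finite x r)
      ⟨x, mem_distBall_self x r⟩
    exact mem_side_of_avoidReach (mem_side_of_adj (h1 ha) hab (Set.disjoint_left.1 hd hb))
      (avoidReach_of_disjoint_distBall h.connected hd hb).symm
  exact Set.disjoint_left.1 (h.disjoint y) (key P hcon.1) (key Q hcon.2)

theorem mem_side_comm (h : P.BallSeparated Q r) (hxz : 2 * r < G.dist x z) :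
    z ∈ Q.side (G.distBall x r) ↔ x ∈ P.side (G.distBall z r) := by
  refine ⟨fun hz => (h.side_le hxz hz).2.1, fun hx => ?_⟩
  refine (h.mem_side_or hxz).resolve_left fun hz => ?_
  exact Set.disjoint_left.1 (h.disjoint z) hx (h.swap.side_le hxz hz).2.1

end BallSeparated

open Classical in
/-- `1` or `-1` if `z` is on the side of `Q` or `P` of the ball of radius `r` around `x`, and `0`
otherwise. -/
noncomputable def sideSign (P Q : G.Ray) (r : ℕ) (x z : V) : ℤ :=
  (if z ∈ Q.side (G.distBall x r) then 1 else 0) - if z ∈ P.side (G.distBall x r) then 1 else 0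

namespace BallSeparated

variable {P Q : G.Ray} {r : ℕ} {x y z : V}

/-- If `z` is far from a walk from `x` to `y`, that walk avoids the ball around `z`, so `x` and `y`
lie on the same side of it; `mem_side_comm` turns this into equality of the two signs at `z`. -/
theorem finite_support_sideSign_sub (h : P.BallSeparated Q r) (x y : V) :
    (Function.support fun z => P.sideSign Q r x z - P.sideSign Q r y z).Finite := by
  classical
  obtain ⟨w⟩ := h.connected.preconnected x y
  refine (w.support.toFinset.finite_toSet.biUnion fun p _ => h.finite p (2 * r)).subset ?_
  intro z hz
  by_contra hcon
  have hfar : ∀ p ∈ w.support, 2 * r < G.dist p z := by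
    intro p hp
    by_contra hle
    exact hcon (Set.mem_biUnion (x := p) (by simpa using hp) (not_lt.1 hle))
  have hxy : G.AvoidReach (G.distBall z r) x y := by
    refine ⟨w, fun p hp hpz => ?_⟩
    have h1 : G.dist z p ≤ r := hpz
    rw [G.dist_comm] at h1
    have := hfar p hp
    omega
  have hx := hfar x w.start_mem_support
  have hy := hfar y w.end_mem_support
  have hside : ∀ R : G.Ray, x ∈ R.side (G.distBall z r) ↔ y ∈ R.side (G.distBall z r) :=
    fun R => ⟨fun h => mem_side_of_avoidReach h hxy, fun h => mem_side_of_avoidReach h hxy.symm⟩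
  apply hz
  simp only [sideSign, h.mem_side_comm hx, h.mem_side_comm hy, h.swap.mem_side_comm hx,
    h.swap.mem_side_comm hy, hside, sub_self]

theorem sideSign_le (h : P.BallSeparated Q r) (hxy : 2 * r < G.dist x y)
    (hy : y ∈ Q.side (G.distBall x r)) (z : V) : P.sideSign Q r y z ≤ P.sideSign Q r x z := by
  obtain ⟨h1, -, h2⟩ := h.side_le hxy hy
  have h3 := @h1 z
  have h4 := @h2 z
  unfold sideSign
  split_ifs <;> first | omega | tauto

theorem sideSign_self (P Q : G.Ray) (r : ℕ) (x : V) : P.sideSign Q r x x = 0 := by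
  have h1 : x ∉ P.side (G.distBall x r) := fun h => side_notMem h (mem_distBall_self x r)
  have h2 : x ∉ Q.side (G.distBall x r) := fun h => side_notMem h (mem_distBall_self x r)
  simp [sideSign, h1, h2]

theorem sideSign_swap (P Q : G.Ray) (r : ℕ) (x z : V) :
    Q.sideSign P r x z = - P.sideSign Q r x z := by
  simp [sideSign]

theorem sideSign_eq_one (h : P.BallSeparated Q r) (hz : z ∈ Q.side (G.distBall x r)) :
    P.sideSign Q r x z = 1 := by
  have : z ∉ P.side (G.distBall x r) := fun h' => Set.disjoint_left.1 (h.disjoint x) h' hz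
  simp [sideSign, this, hz]

/-- The sides are nested, so no term is negative, and the term at `z = y` is `1 - 0`. -/
theorem finsum_pos (h : P.BallSeparated Q r) (hxy : 2 * r < G.dist x y)
    (hy : y ∈ Q.side (G.distBall x r)) :
    0 < ∑ᶠ z, (P.sideSign Q r x z - P.sideSign Q r y z) := by
  have h1 : P.sideSign Q r x y - P.sideSign Q r y y ≤
      ∑ᶠ z, (P.sideSign Q r x z - P.sideSign Q r y z) :=
    single_le_finsum y (h.finite_support_sideSign_sub x y)
      fun z => sub_nonneg.2 (h.sideSign_le hxy hy z)
  rw [h.sideSign_eq_one hy, sideSign_self] at h1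
  omega

theorem finsum_ne_zero (h : P.BallSeparated Q r) (hxy : 2 * r < G.dist x y) :
    ∑ᶠ z, (P.sideSign Q r x z - P.sideSign Q r y z) ≠ 0 := by
  rcases h.mem_side_or hxy with hy | hy
  · have := h.swap.finsum_pos hxy hy
    simp only [sideSign_swap P Q, neg_sub_neg] at this
    rw [← neg_ne_zero, ← finsum_neg_distrib]
    simp only [neg_sub]
    exact this.ne'
  · exact (h.finsum_pos hxy hy).ne'

theorem sideSign_map (h : P.BallSeparated Q r) (hS : P.PairInvariant Q) (g : G ≃g G) :
    ∃ ε : ℤ, (ε = 1 ∨ ε = -1) ∧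
      ∀ x z, P.sideSign Q r (g x) (g z) = ε * P.sideSign Q r x z := by
  classical
  rcases hS g with hg | hg
  · refine ⟨1, .inl rfl, fun x z => ?_⟩
    obtain ⟨h1, h2⟩ := hg _ (h.finite x r)
    rw [image_distBall h.connected] at h1 h2
    have e1 : g z ∈ P.side (G.distBall (g x) r) ↔ z ∈ P.side (G.distBall x r) := by
      rw [h1, g.injective.mem_set_image]
    have e2 : g z ∈ Q.side (G.distBall (g x) r) ↔ z ∈ Q.side (G.distBall x r) := by
      rw [h2, g.injective.mem_set_image]
    rw [sideSign, sideSign, if_congr e1 rfl rfl, if_congr e2 rfl rfl, one_mul]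
  · refine ⟨-1, .inr rfl, fun x z => ?_⟩
    obtain ⟨h1, h2⟩ := hg _ (h.finite x r)
    rw [image_distBall h.connected] at h1 h2
    have e1 : g z ∈ P.side (G.distBall (g x) r) ↔ z ∈ Q.side (G.distBall x r) := by
      rw [h1, g.injective.mem_set_image]
    have e2 : g z ∈ Q.side (G.distBall (g x) r) ↔ z ∈ P.side (G.distBall x r) := by
      rw [h2, g.injective.mem_set_image]
    rw [sideSign, sideSign, if_congr e1 rfl rfl, if_congr e2 rfl rfl]
    ring

end BallSeparated

end Ray

/-- A connected two-ended graph that is transitive on vertices and on edges has a height function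
with finite fibres whose differences every automorphism preserves up to sign. -/
theorem exists_height (hG : G.Connected) (hV : ∀ x y : V, ∃ g : G ≃g G, g x = y)
    (hE : ∀ a b c d : V, G.Adj a b → G.Adj c d →
      ∃ g : G ≃g G, (g a = c ∧ g b = d) ∨ (g a = d ∧ g b = c))
    {P Q : G.Ray} (hPQ : ¬ P.Equivalent Q)
    (hends : ∀ R : G.Ray, R.Equivalent P ∨ R.Equivalent Q) :
    ∃ f : V → ℤ, (∀ k, {x | f x = k}.Finite) ∧ ∀ g : G ≃g G, ∃ ε : ℤ, (ε = 1 ∨ ε = -1) ∧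
      ∀ x y, f (g x) - f (g y) = ε * (f x - f y) := by
  have hS := Ray.pairInvariant_of_two_ends hPQ hends
  have hfin := finite_distBall hG hV hE hS hPQ
  obtain ⟨r, h⟩ := Ray.exists_ballSeparated hG hV hS hPQ hfin
  have x₀ := P.vert 0
  have hsub : ∀ x y, ∑ᶠ z, (P.sideSign Q r x₀ z - P.sideSign Q r x z) -
      ∑ᶠ z, (P.sideSign Q r x₀ z - P.sideSign Q r y z) =
      ∑ᶠ z, (P.sideSign Q r y z - P.sideSign Q r x z) := by
    intro x y
    rw [← finsum_sub_distrib (h.finite_support_sideSign_sub _ _)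
      (h.finite_support_sideSign_sub _ _)]
    simp only [sub_sub_sub_cancel_left]
  -- The sum of signs for a single `x` need not have finite support; only differences from the base
  -- point do. Equal heights force distance at most `2 * r`, so a fibre lies in a finite ball.
  refine ⟨fun x => ∑ᶠ z, (P.sideSign Q r x₀ z - P.sideSign Q r x z), fun k => ?_, fun g => ?_⟩
  · rcases Set.eq_empty_or_nonempty
      {x | ∑ᶠ z, (P.sideSign Q r x₀ z - P.sideSign Q r x z) = k} with he | ⟨x, hx⟩
    · rw [he]; exact Set.finite_empty
    · refine (hfin x (2 * r)).subset fun y hy => ?_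
      by_contra hfar
      refine h.finsum_ne_zero (not_le.1 hfar) ?_
      rw [← hsub y x]
      exact sub_eq_zero.2 (hy.trans hx.symm)
  · obtain ⟨ε, hε, hg⟩ := h.sideSign_map hS g
    refine ⟨ε, hε, fun x y => ?_⟩
    simp only [hsub]
    rw [← finsum_comp_equiv g.toEquiv, mul_finsum]
    · refine finsum_congr fun z => ?_
      have h1 := hg x z
      have h2 := hg y z
      show P.sideSign Q r (g y) (g z) - P.sideSign Q r (g x) (g z) = _
      rw [h1, h2]
      ring

end SimpleGraph

/-! ### Automorphisms and directed walks. -/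

namespace Digraph

variable {V : Type*} {D : Digraph V}

theorem adj_toSimpleGraphInclusive (hloop : D.Loopless) {a b : V} :
    D.toSimpleGraphInclusive.Adj a b ↔ D.Adj a b ∨ D.Adj b a := by
  rw [toSimpleGraphInclusive, SimpleGraph.fromRel_adj]
  refine ⟨fun h => h.2, fun h => ⟨?_, h⟩⟩
  rintro rfl
  exact hloop _ (h.elim id id)

/-- An automorphism of a digraph as an automorphism of the underlying graph. -/
def Aut.toGraphIso (g : D.Aut) : D.toSimpleGraphInclusive ≃g D.toSimpleGraphInclusive where
  toEquiv := g.toEquiv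
  map_rel_iff' {a b} := by
    simp only [toSimpleGraphInclusive, SimpleGraph.fromRel_adj, RelIso.coe_fn_toEquiv,
      g.map_rel_iff, g.injective.ne_iff]

namespace IsHighlyArcTransitive

theorem exists_aut (h : D.IsHighlyArcTransitive) (x y : V) : ∃ g : D.Aut, g x = y := by
  obtain ⟨g, hg⟩ := h 0 ![x] ![y] ⟨fun i => i.elim0, fun i hi => by omega⟩
    ⟨fun i => i.elim0, fun i hi => by omega⟩
  exact ⟨g, hg 0⟩

theorem exists_aut_adj (h : D.IsHighlyArcTransitive) {a b c d : V} (hab : D.Adj a b)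
    (hcd : D.Adj c d) : ∃ g : D.Aut, g a = c ∧ g b = d := by
  have key : ∀ a b, D.Adj a b → D.IsArc 1 ![a, b] := fun a b hab =>
    ⟨fun i => by fin_cases i; exact hab, fun i hi => by omega⟩
  obtain ⟨g, hg⟩ := h 1 _ _ (key a b hab) (key c d hcd)
  exact ⟨g, hg 0, hg 1⟩

theorem exists_aut_adj_adj (h : D.IsHighlyArcTransitive) {a b c a' b' c' : V} (hab : D.Adj a b)
    (hbc : D.Adj b c) (hac : a ≠ c) (hab' : D.Adj a' b') (hbc' : D.Adj b' c') (hac' : a' ≠ c') :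
    ∃ g : D.Aut, g a = a' ∧ g b = b' ∧ g c = c' := by
  have key : ∀ a b c, D.Adj a b → D.Adj b c → a ≠ c → D.IsArc 2 ![a, b, c] :=
    fun a b c hab hbc hac =>
    ⟨fun i => by fin_cases i; exacts [hab, hbc], fun i hi => by
      obtain rfl : i = 0 := by omega
      exact hac⟩
  obtain ⟨g, hg⟩ := h 2 _ _ (key a b c hab hbc hac) (key a' b' c' hab' hbc' hac')
  exact ⟨g, hg 0, hg 1, hg 2⟩

end IsHighlyArcTransitive

theorem IsTwoEnded.exists_rays (h : D.IsTwoEnded) :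
    ∃ P Q : D.toSimpleGraphInclusive.Ray, ¬ P.Equivalent Q ∧
      ∀ R : D.toSimpleGraphInclusive.Ray, R.Equivalent P ∨ R.Equivalent Q := by
  obtain ⟨x, y, hxy, hu⟩ := Nat.card_eq_two_iff.1 h
  obtain ⟨P, rfl⟩ := Quotient.exists_rep x
  obtain ⟨Q, rfl⟩ := Quotient.exists_rep y
  refine ⟨P, Q, fun hPQ => hxy (Quotient.sound hPQ), fun R => ?_⟩
  have hR := hu.ge (Set.mem_univ (Quotient.mk _ R : D.toSimpleGraphInclusive.RayEnd))
  rcases hR with hR | hR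
  · exact .inl (Quotient.exact hR)
  · exact .inr (Quotient.exact hR)

theorem eq_of_forall_adj {α : Type*} (hloop : D.Loopless) (hconn : D.IsConnected) {φ : V → α}
    (h : ∀ a b, D.Adj a b → φ a = φ b) (x y : V) : φ x = φ y := by
  obtain ⟨w⟩ := hconn.preconnected x y
  induction w with
  | nil => rfl
  | cons hab _ ih =>
    rcases (adj_toSimpleGraphInclusive hloop).1 hab with hab | hab
    exacts [(h _ _ hab).trans ih, (h _ _ hab).symm.trans ih]

/-- The vertices that can be reached from a vertex by a directed walk with `s` steps. -/
def stepDesc (D : Digraph V) : ℕ → V → Set V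
  | 0, u => {u}
  | s + 1, u => {v | ∃ w, D.Adj u w ∧ v ∈ D.stepDesc s w}

theorem mem_stepDesc_zero {u v : V} : v ∈ D.stepDesc 0 u ↔ v = u := Iff.rfl

theorem stepDesc_trans {s t : ℕ} {u v w : V} (hv : v ∈ D.stepDesc s u) (hw : w ∈ D.stepDesc t v) :
    w ∈ D.stepDesc (s + t) u := by
  induction s generalizing u with
  | zero =>
    rw [mem_stepDesc_zero] at hv
    subst hv
    rwa [Nat.zero_add]
  | succ s ih =>
    obtain ⟨z, hz, hv⟩ := hv
    rw [Nat.succ_add]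
    exact ⟨z, hz, ih hv⟩

theorem mem_stepDesc_of_forall_adj {p : ℕ → V} (i : ℕ) : ∀ j, (∀ k, i ≤ k → k < i + j →
    D.Adj (p k) (p (k + 1))) → p (i + j) ∈ D.stepDesc j (p i) := by
  intro j
  induction j with
  | zero => exact fun _ => rfl
  | succ j ih =>
    intro h
    exact stepDesc_trans (ih fun k hk hkj => h k hk (by omega))
      ⟨_, h (i + j) (by omega) (by omega), rfl⟩

theorem exists_walk_of_mem_stepDesc {s : ℕ} {u v : V} (h : v ∈ D.stepDesc s u) :
    ∃ p : ℕ → V, p 0 = u ∧ p s = v ∧ ∀ i < s, D.Adj (p i) (p (i + 1)) := by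
  induction s generalizing u with
  | zero => exact ⟨fun _ => u, rfl, h.symm, fun i hi => by omega⟩
  | succ s ih =>
    obtain ⟨w, hw, h⟩ := h
    obtain ⟨p, h0, hs, hp⟩ := ih h
    refine ⟨fun i => Nat.casesOn i u p, rfl, hs, fun i hi => ?_⟩
    cases i with
    | zero => show D.Adj u (p 0); rwa [h0]
    | succ i => exact hp i (by omega)

/-- A shortest directed walk is an arc: if `p i = p (i + 2)`, cutting out these two steps gives a
shorter one. -/
theorem mem_desc_of_mem_stepDesc {s : ℕ} {u v : V} (h : v ∈ D.stepDesc s u) : v ∈ D.desc u := by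
  classical
  have hex : ∃ s, v ∈ D.stepDesc s u := ⟨s, h⟩
  obtain ⟨p, h0, hs, hp⟩ := exists_walk_of_mem_stepDesc (Nat.find_spec hex)
  refine ⟨Nat.find hex, fun i => p i, ⟨fun i => hp i i.2, fun i hi heq => ?_⟩, h0, hs⟩
  have h1 : p (0 + i) ∈ D.stepDesc i (p 0) :=
    mem_stepDesc_of_forall_adj 0 i fun k _ hk => hp k (by omega)
  have h2 : p (i + 2 + (Nat.find hex - (i + 2))) ∈
      D.stepDesc (Nat.find hex - (i + 2)) (p (i + 2)) :=
    mem_stepDesc_of_forall_adj (i + 2) _ fun k _ hk => hp k (by omega)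
  rw [Nat.zero_add, h0] at h1
  rw [Nat.add_sub_cancel' (by omega), hs] at h2
  have heq' : p i = p (i + 2) := heq
  rw [← heq'] at h2
  exact Nat.find_min hex (by omega) (stepDesc_trans h1 h2)

theorem image_stepDesc (g : D.Aut) (s : ℕ) (u : V) :
    g '' D.stepDesc s u = D.stepDesc s (g u) := by
  have key : ∀ (g : D.Aut) (s : ℕ) (u v : V), v ∈ D.stepDesc s u → g v ∈ D.stepDesc s (g u) := by
    intro g s
    induction s with
    | zero => rintro u v rfl; rfl
    | succ s ih =>
      rintro u v ⟨w, hw, hv⟩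
      exact ⟨g w, g.map_rel_iff.2 hw, ih _ _ hv⟩
  refine Set.Subset.antisymm (Set.image_subset_iff.2 fun v => key g s u v) fun v hv => ?_
  refine ⟨g.symm v, ?_, g.apply_symm_apply v⟩
  simpa using key g.symm s _ _ hv

theorem exists_isDirectedLine (hout : ∀ x, ∃ y, D.Adj x y) (hin : ∀ x, ∃ y, D.Adj y x) (x : V) :
    ∃ L : ℤ → V, D.IsDirectedLine L ∧ L 0 = x := by
  choose σ hσ using hout
  choose π hπ using hin
  refine ⟨fun i => Int.casesOn i (fun n => σ^[n] x) (fun n => π^[n + 1] x), fun i => ?_, rfl⟩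
  rcases i with n | _ | n
  · show D.Adj (σ^[n] x) (σ^[n + 1] x)
    rw [Function.iterate_succ_apply']
    exact hσ _
  · exact hπ x
  · show D.Adj (π^[n + 1 + 1] x) (π^[n + 1] x)
    rw [Function.iterate_succ_apply' _ (n + 1)]
    exact hπ _

theorem exists_mem_stepDesc_of_symm (hloop : D.Loopless) (hconn : D.IsConnected)
    (hsymm : ∀ a b, D.Adj a b → D.Adj b a) (x y : V) : ∃ s, y ∈ D.stepDesc s x := by
  obtain ⟨w⟩ := hconn.preconnected x y
  induction w with
  | nil => exact ⟨0, rfl⟩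
  | cons hab _ ih =>
    obtain ⟨s, hs⟩ := ih
    exact ⟨s + 1, _, ((adj_toSimpleGraphInclusive hloop).1 hab).elim id (hsymm _ _), hs⟩

theorem exists_mem_stepDesc (hin : ∀ x, ∃ y, D.Adj y x) (s : ℕ) (v : V) :
    ∃ u, v ∈ D.stepDesc s u := by
  induction s with
  | zero => exact ⟨v, rfl⟩
  | succ s ih =>
    obtain ⟨u, hu⟩ := ih
    obtain ⟨w, hw⟩ := hin u
    exact ⟨w, u, hw, hu⟩

theorem stepDesc_nonempty (hout : ∀ x, ∃ y, D.Adj x y) (s : ℕ) (u : V) :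
    (D.stepDesc s u).Nonempty := by
  induction s generalizing u with
  | zero => exact ⟨u, rfl⟩
  | succ s ih =>
    obtain ⟨w, hw⟩ := hout u
    obtain ⟨v, hv⟩ := ih w
    exact ⟨v, w, hw, hv⟩

/-! ### Heights along edges, and descendants of a line. -/

/-- In a highly arc transitive digraph without 2-cycles, a height function increases by the same
non-zero amount along all edges. -/
theorem exists_const_step [Infinite V] (hloop : D.Loopless) (hconn : D.IsConnected)
    (hhat : D.IsHighlyArcTransitive) (hasymm : ∀ a b, D.Adj a b → ¬ D.Adj b a)
    (hout : ∀ x, ∃ y, D.Adj x y) (hin : ∀ x, ∃ y, D.Adj y x) {f : V → ℤ}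
    (hfin : ∀ k, {x | f x = k}.Finite)
    (hf : ∀ g : D.Aut, ∃ ε : ℤ, (ε = 1 ∨ ε = -1) ∧ ∀ x y, f (g x) - f (g y) = ε * (f x - f y)) :
    ∃ c : ℤ, c ≠ 0 ∧ ∀ a b, D.Adj a b → f b = f a + c := by
  have hne : ∀ a b c, D.Adj a b → D.Adj b c → a ≠ c := by
    rintro a b _ hab hbc rfl
    exact hasymm _ _ hab hbc
  -- The unknown sign occurs twice in a product of two consecutive increments and cancels.
  have hprod : ∀ a b c a' b' c', D.Adj a b → D.Adj b c → D.Adj a' b' → D.Adj b' c' →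
      (f b - f a) * (f c - f b) = (f b' - f a') * (f c' - f b') := by
    intro a b c a' b' c' hab hbc hab' hbc'
    obtain ⟨g, rfl, rfl, rfl⟩ := hhat.exists_aut_adj_adj hab hbc (hne _ _ _ hab hbc) hab' hbc'
      (hne _ _ _ hab' hbc')
    obtain ⟨ε, hε, hg⟩ := hf g
    rw [hg, hg]
    rcases hε with rfl | rfl <;> ring
  obtain ⟨x₀⟩ := hconn.nonempty
  choose σ hσ using hout
  obtain ⟨d, hd⟩ : ∃ d, d = f (σ x₀) - f x₀ := ⟨_, rfl⟩
  have hstep : ∀ a b, D.Adj a b → f b - f a = d ∨ f b - f a = -d := by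
    intro a b hab
    obtain ⟨g, rfl, rfl⟩ := hhat.exists_aut_adj (hσ x₀) hab
    obtain ⟨ε, hε, hg⟩ := hf g
    rw [hg, ← hd]
    rcases hε with rfl | rfl
    · left; ring
    · right; ring
  have hd0 : d ≠ 0 := by
    intro hd0
    refine Set.infinite_univ ((hfin (f x₀)).subset fun x _ => ?_)
    refine eq_of_forall_adj hloop hconn (fun a b hab => ?_) x x₀
    have := hstep a b hab
    omega
  -- All edges out of `a` can be compared through a common edge into `a`.
  have hout_eq : ∀ a b, D.Adj a b → f b - f a = f (σ a) - f a := by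
    intro a b hab
    obtain ⟨p, hp⟩ := hin a
    have h1 := hprod p a b p a (σ a) hp hab hp (hσ a)
    refine mul_left_cancel₀ ?_ h1
    have := hstep p a hp
    omega
  rcases hstep _ _ (hσ (σ x₀)) with h2 | h2
  · refine ⟨d, hd0, fun a b hab => ?_⟩
    have hc := eq_of_forall_adj hloop hconn (φ := fun a => f (σ a) - f a) (fun a b hab => ?_) a x₀
    · have := hout_eq a b hab
      change f (σ a) - f a = f (σ x₀) - f x₀ at hc
      omega
    · have h3 := hprod a b (σ b) x₀ (σ x₀) (σ (σ x₀)) hab (hσ b) (hσ _) (hσ _)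
      rw [← hd, h2] at h3
      have h4 := hout_eq a b hab
      show f (σ a) - f a = f (σ b) - f b
      rw [← h4]
      rcases hstep a b hab with h5 | h5 <;> rcases hstep b _ (hσ b) with h6 | h6 <;>
        rw [h5, h6] at h3 ⊢
      · exact absurd (by nlinarith : d * d = 0) (mul_self_ne_zero.2 hd0)
      · exact absurd (by nlinarith : d * d = 0) (mul_self_ne_zero.2 hd0)
  -- Here increments alternate in sign, so the height takes only two values and the vertex set would
  -- be finite.
  · exfalso
    have hflip : ∀ a b, D.Adj a b → f (σ b) - f b = - (f (σ a) - f a) := by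
      intro a b hab
      have h3 := hprod a b (σ b) x₀ (σ x₀) (σ (σ x₀)) hab (hσ b) (hσ _) (hσ _)
      rw [← hd, h2] at h3
      have h4 := hout_eq a b hab
      rw [← h4]
      rcases hstep a b hab with h5 | h5 <;> rcases hstep b _ (hσ b) with h6 | h6 <;>
        rw [h5, h6] at h3 ⊢
      · exact absurd (by nlinarith : d * d = 0) (mul_self_ne_zero.2 hd0)
      · exact (neg_neg d).symm
      · exact absurd (by nlinarith : d * d = 0) (mul_self_ne_zero.2 hd0)
    have hconst := eq_of_forall_adj hloop hconn (φ := fun a => f (σ a) + f a) (fun a b hab => by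
      have h3 := hflip a b hab
      have h4 := hout_eq a b hab
      show f (σ a) + f a = f (σ b) + f b
      omega)
    refine Set.infinite_univ (((hfin (f x₀)).union (hfin (f (σ x₀)))).subset fun x _ => ?_)
    have h3 : f (σ x) + f x = f (σ x₀) + f x₀ := hconst x x₀
    have h4 := hstep x _ (hσ x)
    show f x = f x₀ ∨ f x = f (σ x₀)
    omega

/-- In a connected vertex-transitive digraph with a height function that has finite fibres and
increases by a constant along the edges, every vertex can be reached from any directed line. -/
theorem exists_mem_stepDesc_line (hloop : D.Loopless) (hconn : D.IsConnected)
    (hV : ∀ x y : V, ∃ g : D.Aut, g x = y)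
    (hout : ∀ x, ∃ y, D.Adj x y) (hin : ∀ x, ∃ y, D.Adj y x) {f : V → ℤ}
    (hfin : ∀ k, {x | f x = k}.Finite) {c : ℤ} (hc : c ≠ 0)
    (hf : ∀ a b, D.Adj a b → f b = f a + c) {L : ℤ → V} (hL : D.IsDirectedLine L) (y : V) :
    ∃ i s, y ∈ D.stepDesc s (L i) := by
  have hS : ∀ s u v, v ∈ D.stepDesc s u → f v = f u + c * s := by
    intro s
    induction s with
    | zero => rintro u v rfl; simp
    | succ s ih =>
      rintro u v ⟨w, hw, hv⟩
      rw [ih _ _ hv, hf _ _ hw]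
      push_cast
      ring
  have hSfin : ∀ s u, (D.stepDesc s u).Finite := fun s u =>
    (hfin _).subset fun v hv => hS s u v hv
  have hshift : ∀ (g : D.Aut) (x y : V), f (g x) - f x = f (g y) - f y := fun g =>
    eq_of_forall_adj hloop hconn fun a b hab => by
      have h1 := hf a b hab
      have h2 := hf _ _ (g.map_rel_iff.2 hab)
      omega
  obtain ⟨x, hx⟩ : ∃ x, x = L 0 := ⟨_, rfl⟩
  have hcard : ∀ s u, (D.stepDesc s u).ncard = (D.stepDesc s x).ncard := by
    intro s u
    obtain ⟨g, rfl⟩ := hV x u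
    rw [← image_stepDesc, Set.ncard_image_of_injective _ g.injective]
  have hmono : Monotone fun s => (D.stepDesc s x).ncard := by
    refine monotone_nat_of_le_succ fun s => ?_
    obtain ⟨w, hw⟩ := hout x
    rw [← hcard s w]
    exact Set.ncard_le_ncard (fun v hv => ⟨w, hw, hv⟩) (hSfin _ _)
  -- All of `stepDesc s x` lies in a single fibre, which is a translate of the fibre of `x`.
  have hbdd : BddAbove (Set.range fun s => (D.stepDesc s x).ncard) := by
    refine ⟨{z | f z = f x}.ncard, ?_⟩
    rintro _ ⟨s, rfl⟩
    obtain ⟨v, hv⟩ := stepDesc_nonempty hout s x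
    obtain ⟨g, rfl⟩ := hV x v
    have hsub : D.stepDesc s x ⊆ g '' {z | f z = f x} := by
      intro z hz
      refine ⟨g.symm z, ?_, g.apply_symm_apply z⟩
      have h1 := hshift g (g.symm z) x
      rw [g.apply_symm_apply, hS s x z hz, hS s x _ hv] at h1
      show f (g.symm z) = f x
      omega
    calc _ ≤ _ := Set.ncard_le_ncard hsub ((hfin _).image g)
      _ = _ := Set.ncard_image_of_injective _ g.injective
  obtain ⟨s₀, hs₀⟩ := Nat.sSup_mem (Set.range_nonempty fun s => (D.stepDesc s x).ncard) hbdd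
  have hstab : ∀ s, s₀ ≤ s → (D.stepDesc s x).ncard = (D.stepDesc s₀ x).ncard := fun s hs =>
    le_antisymm ((le_csSup hbdd ⟨s, rfl⟩).trans hs₀.ge) (hmono hs)
  -- The inclusion is between finite sets that both have the maximal size, so it is an equality.
  have hedge : ∀ a b, D.Adj a b → ∀ s, s₀ ≤ s → D.stepDesc (s + 1) a = D.stepDesc s b := by
    intro a b hab s hs
    have hsub : D.stepDesc s b ⊆ D.stepDesc (s + 1) a := fun v hv => ⟨b, hab, hv⟩
    refine (Set.eq_of_subset_of_ncard_le hsub ?_ (hSfin _ _)).symm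
    rw [hcard _ a, hcard _ b, hstab _ hs, hstab _ (by omega)]
  have hmerge : ∀ u, ∃ i j, ∀ s, s₀ ≤ s → D.stepDesc (s + i) x = D.stepDesc (s + j) u := by
    intro u
    obtain ⟨w⟩ := hconn.preconnected u x
    generalize x = x' at w
    induction w with
    | nil => exact ⟨0, 0, fun _ _ => rfl⟩
    | cons hab _ ih =>
      obtain ⟨i, j, hij⟩ := ih
      rcases (adj_toSimpleGraphInclusive hloop).1 hab with hab | hab
      · exact ⟨i, j + 1, fun s hs => (hij s hs).trans (hedge _ _ hab (s + j) (by omega)).symm⟩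
      · refine ⟨i + 1, j, fun s hs => ?_⟩
        rw [show s + (i + 1) = s + 1 + i by omega, hij (s + 1) (by omega),
          show s + 1 + j = s + j + 1 by omega, hedge _ _ hab _ (by omega)]
  have hmerge' : ∀ u, f u = f x → ∃ i, ∀ s, i ≤ s → D.stepDesc s x = D.stepDesc s u := by
    intro u hu
    obtain ⟨i, j, hij⟩ := hmerge u
    obtain ⟨v, hv⟩ := stepDesc_nonempty hout (s₀ + i) x
    have h1 := hS _ _ _ hv
    rw [hij _ le_rfl] at hv
    have h2 := hS _ _ _ hv
    rw [h1, hu, add_right_inj] at h2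
    -- Equal starting heights and a common descendant force equal numbers of steps.
    have h3 := mul_left_cancel₀ hc h2
    obtain rfl : i = j := by omega
    refine ⟨s₀ + i, fun s hs => ?_⟩
    have := hij (s - i) (by omega)
    rwa [Nat.sub_add_cancel (by omega)] at this
  choose! I hI using hmerge'
  obtain ⟨M, hM⟩ := ((hfin (f x)).image I).bddAbove
  -- Each `v` on this level has an ancestor `s` steps up, in the fibre of `x`. `M` bounds the
  -- thresholds over that finite fibre, so the ancestor may be replaced by `x`.
  have hlevel : ∀ s, M ≤ s → ∀ v, f v = f x + c * s → v ∈ D.stepDesc s x := by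
    intro s hs v hv
    obtain ⟨u, hu⟩ := exists_mem_stepDesc hin s v
    have hux : f u = f x := by
      have := hS _ _ _ hu
      omega
    rw [hI u hux s ((hM ⟨u, hux, rfl⟩).trans hs)]
    exact hu
  have hline : ∀ n : ℕ, f x = f (L (-n)) + c * n := by
    intro n
    induction n with
    | zero => simp [hx]
    | succ n ih =>
      have := hf _ _ (hL (-(n + 1 : ℕ)))
      rw [show -((n + 1 : ℕ) : ℤ) + 1 = -n by push_cast; ring] at this
      rw [ih, this]
      push_cast
      ring
  obtain ⟨m, hm⟩ : c ∣ f y - f x := by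
    refine (eq_of_forall_adj hloop hconn (φ := fun a => c ∣ f a - f x) (fun a b hab => ?_) x y).mp
      (by simp)
    show (c ∣ f a - f x) = (c ∣ f b - f x)
    rw [hf a b hab, add_sub_right_comm, dvd_add_self_right]
  -- Starting at `L (-n)` with `n = M + |m|`, the level of `y` is `m + n ≥ M` steps away, so
  -- `hlevel` applies after translating `x` to `L (-n)`.
  have hn : 0 ≤ m + (M + m.natAbs : ℕ) ∧ (M : ℤ) ≤ m + (M + m.natAbs : ℕ) := by omega
  obtain ⟨g, hg⟩ := hV x (L (-(M + m.natAbs : ℕ)))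
  obtain ⟨t, ht⟩ := Int.eq_ofNat_of_zero_le hn.1
  refine ⟨-(M + m.natAbs : ℕ), t, ?_⟩
  rw [← hg, ← image_stepDesc]
  refine ⟨g.symm y, hlevel t (by omega) _ ?_, g.apply_symm_apply y⟩
  have h1 := hshift g (g.symm y) x
  have h2 := hline (M + m.natAbs)
  rw [g.apply_symm_apply, hg] at h1
  rw [← ht]
  linear_combination hm - h1 + h2

end Digraph

/-! ### The main theorem. -/

theorem theorem3 {V : Type*} (D : Digraph V) (hloop : D.Loopless) (hconn : D.IsConnected)
    (hends : D.IsTwoEnded) (hhat : D.IsHighlyArcTransitive) :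
    ∃ L : ℤ → V, D.IsDirectedLine L ∧ D.descSet (Set.range L) = Set.univ := by
  obtain ⟨P, Q, hPQ, hR⟩ := hends.exists_rays
  have : Infinite V := Infinite.of_injective _ P.inj
  obtain ⟨a₀, b₀, hab₀⟩ : ∃ a b, D.Adj a b := by
    rcases (Digraph.adj_toSimpleGraphInclusive hloop).1 (P.adj 0) with h | h
    exacts [⟨_, _, h⟩, ⟨_, _, h⟩]
  have hout : ∀ x, ∃ y, D.Adj x y := fun x => by
    obtain ⟨g, rfl⟩ := hhat.exists_aut a₀ x
    exact ⟨g b₀, g.map_rel_iff.2 hab₀⟩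
  have hin : ∀ x, ∃ y, D.Adj y x := fun x => by
    obtain ⟨g, rfl⟩ := hhat.exists_aut b₀ x
    exact ⟨g a₀, g.map_rel_iff.2 hab₀⟩
  obtain ⟨L, hL, -⟩ := Digraph.exists_isDirectedLine hout hin a₀
  refine ⟨L, hL, ?_⟩
  suffices h : ∀ y, ∃ i s, y ∈ D.stepDesc s (L i) by
    refine Set.eq_univ_of_forall fun y => ?_
    obtain ⟨i, s, hy⟩ := h y
    exact Set.mem_biUnion (Set.mem_range_self i) (Digraph.mem_desc_of_mem_stepDesc hy)
  by_cases hcycle : ∃ a b, D.Adj a b ∧ D.Adj b a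
  · obtain ⟨a, b, hab, hba⟩ := hcycle
    refine fun y => ⟨0, Digraph.exists_mem_stepDesc_of_symm hloop hconn (fun u v huv => ?_) _ _⟩
    obtain ⟨g, rfl, rfl⟩ := hhat.exists_aut_adj hab huv
    exact g.map_rel_iff.2 hba
  · push Not at hcycle
    obtain ⟨f, hfin, hf⟩ := SimpleGraph.exists_height hconn
      (fun x y => by
        obtain ⟨g, hg⟩ := hhat.exists_aut x y
        exact ⟨g.toGraphIso, hg⟩)
      (fun a b c d hab hcd => by
        rw [Digraph.adj_toSimpleGraphInclusive hloop] at hab hcd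
        rcases hab with hab | hab <;> rcases hcd with hcd | hcd <;>
          obtain ⟨g, h1, h2⟩ := hhat.exists_aut_adj hab hcd
        exacts [⟨g.toGraphIso, .inl ⟨h1, h2⟩⟩, ⟨g.toGraphIso, .inr ⟨h1, h2⟩⟩,
          ⟨g.toGraphIso, .inr ⟨h2, h1⟩⟩, ⟨g.toGraphIso, .inl ⟨h2, h1⟩⟩])
      hPQ hR
    obtain ⟨c, hc, hstep⟩ := Digraph.exists_const_step hloop hconn hhat hcycle hout hin hfin
      fun g => hf g.toGraphIso
    exact Digraph.exists_mem_stepDesc_line hloop hconn hhat.exists_aut hout hin hfin hc hstep hL
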